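/- Fix a finite vocabulary, indexed by $j$, known intercepts $\alpha=(\alpha_j)$, loadings $\varphi=(\varphi_j)$ and $\pi>0$. For $y\in\{0,1\}$ put $q_j(y)=\exp(\alpha_j+\varphi_j y)/\sum_l\exp(\alpha_l+\varphi_l y)$. Since adding a constant to all $\varphi_j$ does not change the model, the loadings are identified by a linear normalization $c'\varphi=0$ with a fixed vector $c$ such that $\sum_j c_j\neq 0$ (for example $\varphi_r=0$ for a reference word $r$, or $\sum_j\varphi_j=0$). For each $n$ let a corpus of documents $(x_i,y_i)$ be given, with prescribed document lengths $m_i$ (number of documents and lengths may depend on $n$), where the pairs $(x_i,y_i)$ are independent with joint law $p(x,y)=\mathrm{MN}(x\mid q(y),m_i)\,p(y)$, $y$ binary with $\mathrm{E}[y]=\pi$. Let $M=\sum_i\sum_j x_{ij}$ be the total number of words, and assume that $M\to\infty$ and $\max_i m_i/M\to 0$ as $n\to\infty$ (for instance, independent word-sentiment pairs, $m_i=1$, or documents of bounded length). Let $\hat\varphi$ be a measurable estimator that, almost surely, maximizes over $\{\psi: c'\psi=0\}$ the likelihood of $\psi$ in the collapsed model, in which $\sum_{i:y_i=b}x_i$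 is multinomial with probabilities $q(b)$ for $b=0,1$, whenever a maximizer exists. Let $q_1=q(1)$ and $W=\mathrm{diag}(q_1)-q_1q_1'$. Since the rows of $W$ sum to zero, $W^{-1}$ is understood on the normalized loadings: there is exactly one matrix $W^{-1}$ with $W^{-1}Wv=v$ for all $v$ with $c'v=0$, and $W^{-1}c=0$ (for the normalization $\varphi_r=0$ it is the ordinary inverse of $W$ without row and column $r$, bordered with zeros). It is positive semidefinite, and as $n\to\infty$ $$\sqrt{\pi M}\,(\hat\varphi-\varphi)\;\rightsquigarrow\;\mathrm{N}(0,W^{-1}).$$ -/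

import Mathlib

open MeasureTheory ProbabilityTheory Filter Topology

noncomputable section

namespace MNIR

variable {ι : Type*} [Fintype ι]

/-- The softmax word probabilities `q_j(y) = exp(α_j + φ_j y) / ∑_l exp(α_l + φ_l y)` over the
finite vocabulary `ι`, for a binary response `y ∈ {0, 1}`. -/
def wordProb (α : ι → ℝ) (φ : EuclideanSpace ℝ ι) (y : Fin 2) (j : ι) : ℝ :=
  Real.exp (α j + φ j * ((y : ℕ) : ℝ)) / ∑ l, Real.exp (α l + φ l * ((y : ℕ) : ℝ))

/-- The multinomial probability mass function `MN(k | q, m)`: the probability of the count vector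
`k` in `m` independent draws from the vocabulary with word probabilities `q`. -/
def multinomialMass (m : ℕ) (q : ι → ℝ) (k : ι → ℕ) : ℝ :=
  if ∑ j, k j = m then (Nat.multinomial Finset.univ k : ℝ) * ∏ j, q j ^ k j else 0

/-- The marginal `p(y)` of a binary response with mean `p`. -/
def responseMass (p : ℝ) (y : Fin 2) : ℝ := if y = 1 then p else 1 - p

/-- Documents indexed by `D`, document `i` having `m i` words, word counts `x i` and response
`y i`, that are independent draws from the joint model `p(x, y) = MN(x | q(y), m i) p(y)`
with `E[y] = p`. -/
structure IsSample {Ω : Type*} [MeasurableSpace Ω] {D : Type*} (μ : Measure Ω)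
    (α : ι → ℝ) (φ : EuclideanSpace ℝ ι) (p : ℝ) (m : D → ℕ)
    (x : D → Ω → ι → ℕ) (y : D → Ω → Fin 2) : Prop where
  measurable_counts : ∀ i, Measurable (x i)
  measurable_response : ∀ i, Measurable (y i)
  indep : iIndepFun (fun i ω ↦ (x i ω, y i ω)) μ
  law : ∀ i (k : ι → ℕ) (b : Fin 2),
    μ.real {ω | x i ω = k ∧ y i ω = b} =
      multinomialMass (m i) (wordProb α φ b) k * responseMass p b

/-- The total number of words `M = ∑_i ∑_j x_ij`. -/
def totalWords {D : Type*} [Fintype D] (x : D → ι → ℕ) : ℕ := ∑ i, ∑ j, x i j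

/-- The collapsed word counts: the total count of word `j` over the documents with response `b`. -/
def collapsedCounts {D : Type*} [Fintype D] (x : D → ι → ℕ) (y : D → Fin 2) (b : Fin 2) (j : ι) :
    ℕ :=
  ∑ i with y i = b, x i j

/-- The likelihood of the loadings `ψ` in the collapsed model, in which, for each value `b` of the
response, the collapsed counts are multinomial with word probabilities `q(b)`. -/
def collapsedLikelihood {D : Type*} [Fintype D] (α : ι → ℝ) (x : D → ι → ℕ) (y : D → Fin 2)
    (ψ : EuclideanSpace ℝ ι) : ℝ :=
  ∏ b : Fin 2, multinomialMass (∑ j, collapsedCounts x y b j) (wordProb α ψ b)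
    (collapsedCounts x y b)

/-- The normalized loadings. Adding a constant to all loadings does not change the model, so they
are identified by a linear normalization `∑ j, c j * φ j = 0` with `∑ j, c j ≠ 0`
(a reference word `φ_r = 0`, or loadings that sum to zero, for instance). -/
def paramSpace (c : ι → ℝ) : Set (EuclideanSpace ℝ ι) := {ψ | ∑ j, c j * ψ j = 0}

/-- `ψ` is a maximum likelihood estimate of the loadings in the collapsed model. -/
def IsMLE {D : Type*} [Fintype D] (α : ι → ℝ) (c : ι → ℝ) (x : D → ι → ℕ) (y : D → Fin 2)
    (ψ : EuclideanSpace ℝ ι) : Prop :=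
  ψ ∈ paramSpace c ∧ IsMaxOn (collapsedLikelihood α x y) (paramSpace c) ψ

/-- The matrix `W = diag(q₁) - q₁ q₁'` with `q₁ = q(1)`. -/
def infoMatrix [DecidableEq ι] (α : ι → ℝ) (φ : EuclideanSpace ℝ ι) : Matrix ι ι ℝ :=
  Matrix.diagonal (wordProb α φ 1) - Matrix.vecMulVec (wordProb α φ 1) (wordProb α φ 1)

/-- `V` is the inverse `W⁻¹` on the normalized loadings. The rows of `W = diag(q₁) - q₁ q₁'` sum to
zero, so that `W` is only invertible as a form on the hyperplane of normalized loadings; its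
inverse, as a covariance matrix of vectors of that hyperplane, is the matrix `V` with `V W v = v`
for all `v` in the hyperplane and `V c = 0`. If `c` is the indicator of a reference word `r`, this
is the ordinary inverse of `W` without row and column `r`, bordered with zeros; if `c` is constant,
it is the Moore-Penrose inverse. -/
structure IsInverseOn (c : ι → ℝ) (W V : Matrix ι ι ℝ) : Prop where
  left_inv : ∀ v : ι → ℝ, ∑ j, c j * v j = 0 → V.mulVec (W.mulVec v) = v
  mulVec_normal : V.mulVec c = 0

end MNIR

end

/-!
Only the collapsed counts `X` of response `1` carry information on the loadings, since `q(0)` does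
not depend on them. If every word occurs in `X`, Gibbs' inequality shows that the maximum likelihood
estimate exists, is unique and fits the frequencies, `q(1) = X / T` with `T = ∑ j, X j`. Hence the
estimate has a closed form: with `P` (`normalize c`) the projection onto the normalized loadings
along the constants,
`φhat - φ = P (log (X j / (T * q j)))_j` (`IsMLE.sub_eq`).
The statement is then a delta method for the score `S j = X j / q j - T`.

Centering at the random total `T` and not at the mean of `X` matters. The variance of `T` is of
order `∑ m i ^ 2`, which is only `o(M²)`, so that `X` itself need not satisfy a central limit
theorem at scale `√M`. The score does: its summands are independent over documents, and by the
multinomial theorem the summand of a document of length `m` has characteristic function `(1 - p) + p χ ^ m`,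
where `χ` belongs to a single centered word. A second order expansion of `χ`, together with
`∑ m i ^ 2 = o(M²)`, gives
`S / √(p M) ⇝ N(0, diag(q)⁻¹ - 1 1')` (`tendstoInDistribution_score`),
whereas `T / (p M) → 1` in probability by Chebyshev's inequality
(`tendsto_measure_collapsed_total`).

The scaled error is a continuous function (`errorMap`) of `S / √(p M)`, `T / (p M)` and
`1 / √(p M)`, as long as these lie in an open set that contains the limit; this set also forces all
words to occur (`smul_sub_eq_errorMap`). A local form of Slutsky's theorem
(`tendstoInDistribution_of_eq_comp_of_mem_open`) yields the limit `P N(0, diag(q)⁻¹ - 1 1')`. Since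
`P` kills constants, its covariance is `P diag(q)⁻¹ P'`, which is the only inverse of
`W = diag(q) - q q'` on the normalized loadings (`IsInverseOn.eq_asymptoticCov`).
-/

namespace MNIR

/-! ### Slutsky's theorem on varying probability spaces -/

section Slutsky

variable {Ω : ℕ → Type*} {mΩ : ∀ n, MeasurableSpace (Ω n)} {μ : ∀ n, Measure (Ω n)}
  [∀ n, IsProbabilityMeasure (μ n)] {Ω' : Type*} {m' : MeasurableSpace Ω'} {μ' : Measure Ω'}
  [IsProbabilityMeasure μ']

lemma map_comp_eval_infinitePi {E : Type*} [MeasurableSpace E] {n : ℕ} {X : Ω n → E}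
    (hX : AEMeasurable X (μ n)) :
    (Measure.infinitePi μ).map (fun ω ↦ X (ω n)) = (μ n).map X := by
  have h := measurePreserving_eval_infinitePi μ n
  rw [← h.map_eq] at hX
  rw [← h.map_eq, AEMeasurable.map_map_of_aemeasurable hX h.measurable.aemeasurable]
  rfl

/-- Convergence in distribution only involves the laws, so that variables living on different
spaces may be moved to the product of these spaces. -/
lemma tendstoInDistribution_comp_eval_iff {E : Type*} [TopologicalSpace E] [MeasurableSpace E]
    [OpensMeasurableSpace E] {X : ∀ n, Ω n → E} {Z : Ω' → E} (hX : ∀ n, AEMeasurable (X n) (μ n)) :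
    TendstoInDistribution (fun n (ω : ∀ n, Ω n) ↦ X n (ω n)) atTop Z
        (fun _ ↦ Measure.infinitePi μ) μ' ↔
      TendstoInDistribution X atTop Z μ μ' := by
  have hX' : ∀ n, AEMeasurable (fun ω : ∀ n, Ω n ↦ X n (ω n)) (Measure.infinitePi μ) := fun n ↦
    (hX n).comp_quasiMeasurePreserving
      (measurePreserving_eval_infinitePi μ n).quasiMeasurePreserving
  have key : ∀ n, (⟨(Measure.infinitePi μ).map (fun ω ↦ X n (ω n)),
      Measure.isProbabilityMeasure_map (hX' n)⟩ : ProbabilityMeasure E) =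
      ⟨(μ n).map (X n), Measure.isProbabilityMeasure_map (hX n)⟩ := fun n ↦
    Subtype.ext (map_comp_eval_infinitePi (hX n))
  constructor
  · intro h
    exact ⟨hX, h.aemeasurable_limit, by simpa only [key] using h.tendsto⟩
  · intro h
    exact ⟨hX', h.aemeasurable_limit, by simpa only [key] using h.tendsto⟩

/-- A local form of Slutsky's theorem: it suffices that `Y n = g (X n, R n)` where `(X n, R n)`
lies in an open set that almost surely contains the limit `(Z, c)`. -/
theorem tendstoInDistribution_of_eq_comp_of_mem_open {E E' F : Type*}
    [NormedAddCommGroup E] [SecondCountableTopology E] [MeasurableSpace E] [BorelSpace E]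
    [NormedAddCommGroup E'] [SecondCountableTopology E'] [MeasurableSpace E'] [BorelSpace E']
    [NormedAddCommGroup F] [SecondCountableTopology F] [MeasurableSpace F] [BorelSpace F]
    {X : ∀ n, Ω n → E} {R : ∀ n, Ω n → E'} {Y : ∀ n, Ω n → F} {Z : Ω' → E} {c : E'}
    (hX : TendstoInDistribution X atTop Z μ μ') (hRm : ∀ n, AEMeasurable (R n) (μ n))
    (hR : ∀ ε : ℝ, 0 < ε → Tendsto (fun n ↦ (μ n).real {ω | ε ≤ ‖R n ω - c‖}) atTop (𝓝 0))
    {g : E × E' → F} (hg : Continuous g) {U : Set (E × E')} (hU : IsOpen U)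
    (hUZ : ∀ᵐ ω ∂μ', (Z ω, c) ∈ U) (hYm : ∀ n, AEMeasurable (Y n) (μ n))
    (hY : ∀ n, ∀ᵐ ω ∂μ n, (X n ω, R n ω) ∈ U → Y n ω = g (X n ω, R n ω)) :
    TendstoInDistribution Y atTop (fun ω ↦ g (Z ω, c)) μ μ' := by
  have hq := fun n ↦ (measurePreserving_eval_infinitePi μ n).quasiMeasurePreserving
  have hXm := hX.forall_aemeasurable
  rw [← tendstoInDistribution_comp_eval_iff hYm]
  rw [← tendstoInDistribution_comp_eval_iff hXm] at hX
  have hR' : TendstoInMeasure (Measure.infinitePi μ) (fun n (ω : ∀ n, Ω n) ↦ R n (ω n)) atTop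
      (fun _ ↦ c) := by
    rw [tendstoInMeasure_iff_measureReal_norm]
    intro ε hε
    refine (hR ε hε).congr fun n ↦ ?_
    refine ((measurePreserving_eval_infinitePi μ n).measureReal_preimage ?_).symm
    exact nullMeasurableSet_le aemeasurable_const ((hRm n).sub_const c).norm
  have hRm' : ∀ n, AEMeasurable (fun ω : ∀ n, Ω n ↦ R n (ω n)) (Measure.infinitePi μ) :=
    fun n ↦ (hRm n).comp_quasiMeasurePreserving (hq n)
  have hYm' : ∀ n, AEMeasurable (fun ω : ∀ n, Ω n ↦ Y n (ω n)) (Measure.infinitePi μ) :=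
    fun n ↦ (hYm n).comp_quasiMeasurePreserving (hq n)
  have hXR := hX.prodMk_of_tendstoInMeasure_const _ _ _ hR' hRm'
  have hY' : ∀ n, ∀ᵐ ω ∂Measure.infinitePi μ, (X n (ω n), R n (ω n)) ∈ U →
      Y n (ω n) = g (X n (ω n), R n (ω n)) := fun n ↦ (hq n).ae (hY n)
  refine tendstoInDistribution_of_tendstoInMeasure_sub _ _ (hXR.continuous_comp hg) ?_ hYm'
  have hlim := ProbabilityMeasure.limsup_measure_closed_le_of_tendsto hXR.tendsto
    hU.isClosed_compl
  have hzero : (μ'.map fun ω ↦ (Z ω, c)) Uᶜ = 0 := by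
    rw [Measure.map_apply_of_aemeasurable hXR.aemeasurable_limit hU.measurableSet.compl]
    exact hUZ
  simp only [ProbabilityMeasure.coe_mk] at hlim
  rw [hzero] at hlim
  have htend : Tendsto (fun n ↦ (Measure.infinitePi μ)
      {ω | (X n (ω n), R n (ω n)) ∈ Uᶜ}) atTop (𝓝 0) := by
    refine tendsto_of_le_liminf_of_limsup_le bot_le ?_
    refine le_trans (le_of_eq ?_) hlim
    congr 1
    ext n
    rw [Measure.map_apply_of_aemeasurable (hXR.forall_aemeasurable n) hU.measurableSet.compl]
    rfl
  intro ε hε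
  refine tendsto_of_tendsto_of_tendsto_of_le_of_le tendsto_const_nhds htend (fun _ ↦ bot_le) ?_
  intro n
  refine measure_mono_ae ?_
  filter_upwards [hY' n] with ω hω hmem
  by_contra hUm
  have h1 : (X n (ω n), R n (ω n)) ∈ U := by
    by_contra h
    exact hUm h
  have h2 : ε ≤ edist (Y n (ω n) - g (X n (ω n), R n (ω n))) 0 := hmem
  rw [hω h1, sub_self, edist_self] at h2
  exact absurd h2 (not_le.2 hε)

end Slutsky

/-! ### Asymptotics of products of characteristic functions -/

section Products

lemma norm_prod_sub_prod_le {κ : Type*} (s : Finset κ) (z w : κ → ℂ) (hz : ∀ i ∈ s, ‖z i‖ ≤ 1)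
    (hw : ∀ i ∈ s, ‖w i‖ ≤ 1) : ‖∏ i ∈ s, z i - ∏ i ∈ s, w i‖ ≤ ∑ i ∈ s, ‖z i - w i‖ := by
  classical
  induction s using Finset.induction_on with
  | empty => simp
  | insert a s ha ih =>
    rw [Finset.prod_insert ha, Finset.prod_insert ha, Finset.sum_insert ha]
    have h1 := ih (fun i hi ↦ hz i (Finset.mem_insert_of_mem hi))
      (fun i hi ↦ hw i (Finset.mem_insert_of_mem hi))
    have h2 : ‖∏ i ∈ s, z i‖ ≤ 1 := by
      rw [norm_prod]
      exact Finset.prod_le_one (fun _ _ ↦ norm_nonneg _)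
        (fun i hi ↦ hz i (Finset.mem_insert_of_mem hi))
    have h3 := hw a (Finset.mem_insert_self a s)
    calc ‖z a * ∏ i ∈ s, z i - w a * ∏ i ∈ s, w i‖
        = ‖(z a - w a) * ∏ i ∈ s, z i + w a * (∏ i ∈ s, z i - ∏ i ∈ s, w i)‖ := by ring_nf
      _ ≤ ‖z a - w a‖ * ‖∏ i ∈ s, z i‖ + ‖w a‖ * ‖∏ i ∈ s, z i - ∏ i ∈ s, w i‖ := by
        rw [← norm_mul, ← norm_mul]; exact norm_add_le _ _
      _ ≤ ‖z a - w a‖ * 1 + 1 * ∑ i ∈ s, ‖z i - w i‖ := by gcongr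
      _ = _ := by ring

lemma norm_pow_sub_pow_le (z w : ℂ) (hz : ‖z‖ ≤ 1) (hw : ‖w‖ ≤ 1) (m : ℕ) :
    ‖z ^ m - w ^ m‖ ≤ m * ‖z - w‖ := by
  simpa using norm_prod_sub_prod_le (Finset.range m) (fun _ ↦ z) (fun _ ↦ w) (fun _ _ ↦ hz)
    (fun _ _ ↦ hw)

lemma abs_exp_neg_sub_one_add_le {u : ℝ} (hu : 0 ≤ u) : |Real.exp (-u) - 1 + u| ≤ u ^ 2 := by
  rcases le_total u 1 with h | h
  · have := Real.abs_exp_sub_one_sub_id_le (x := -u) (by rwa [abs_neg, abs_of_nonneg hu])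
    simpa using this
  · have h1 := Real.add_one_le_exp (-u)
    have h2 : Real.exp (-u) ≤ 1 := Real.exp_le_one_iff.2 (by linarith)
    rw [abs_of_nonneg (by linarith)]
    nlinarith

variable {ι : Type*} [Fintype ι]

/-- Second order expansion of the characteristic function of a centered law on finitely many
points `a j`. -/
lemma norm_sum_exp_sub_exp_le {q a : ι → ℝ} (hq : ∀ j, 0 ≤ q j) (hq1 : ∑ j, q j = 1)
    (hqa : ∑ j, q j * a j = 0) {s : ℝ} (hs0 : 0 ≤ s) (hs : ∀ j, |s * a j| ≤ 1) :
    ‖(∑ j, (q j : ℂ) * Complex.exp ((s * a j : ℝ) * Complex.I)) -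
        (Real.exp (-(s ^ 2 * ((∑ j, q j * a j ^ 2) / 2))) : ℂ)‖ ≤
      (∑ j, q j * |a j| ^ 3) * s ^ 3 + (s ^ 2 * ((∑ j, q j * a j ^ 2) / 2)) ^ 2 := by
  set θ : ℝ := s ^ 2 * ((∑ j, q j * a j ^ 2) / 2) with hθ
  have hθ0 : 0 ≤ θ := mul_nonneg (sq_nonneg s)
    (div_nonneg (Finset.sum_nonneg fun j _ ↦ mul_nonneg (hq j) (sq_nonneg _)) zero_le_two)
  have h1 : ‖(∑ j, (q j : ℂ) * Complex.exp ((s * a j : ℝ) * Complex.I)) - ((1 - θ : ℝ) : ℂ)‖ ≤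
      (∑ j, q j * |a j| ^ 3) * s ^ 3 := by
    -- The first order terms cancel since `a` is centered.
    have e : ((1 - θ : ℝ) : ℂ) = ∑ j, (q j : ℂ) *
        ∑ m ∈ Finset.range 3, (((s * a j : ℝ) : ℂ) * Complex.I) ^ m / (m.factorial : ℂ) := by
      have e1 : ∀ j, (q j : ℂ) *
          ∑ m ∈ Finset.range 3, (((s * a j : ℝ) : ℂ) * Complex.I) ^ m / (m.factorial : ℂ) =
          ((q j - s ^ 2 / 2 * (q j * a j ^ 2) : ℝ) : ℂ) + ((q j * a j : ℝ) : ℂ) *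
            (s * Complex.I) := by
        intro j
        simp only [Finset.sum_range_succ, Finset.sum_range_zero, Nat.factorial]
        push_cast
        rw [mul_pow _ Complex.I 2, Complex.I_sq]
        ring
      rw [Finset.sum_congr rfl fun j _ ↦ e1 j, Finset.sum_add_distrib, ← Finset.sum_mul,
        ← Complex.ofReal_sum, ← Complex.ofReal_sum, hqa, Finset.sum_sub_distrib, hq1,
        ← Finset.mul_sum, hθ]
      push_cast
      ring
    rw [e, ← Finset.sum_sub_distrib, Finset.sum_mul]
    refine (norm_sum_le _ _).trans (Finset.sum_le_sum fun j _ ↦ ?_)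
    rw [← mul_sub, norm_mul, Complex.norm_real, Real.norm_of_nonneg (hq j), mul_assoc]
    refine mul_le_mul_of_nonneg_left ?_ (hq j)
    have hn : ‖((s * a j : ℝ) : ℂ) * Complex.I‖ = |s * a j| := by simp
    refine (Complex.exp_bound (by rw [hn]; exact hs j) (n := 3) (by norm_num)).trans ?_
    rw [hn, abs_mul, abs_of_nonneg hs0, mul_pow]
    have : (0 : ℝ) ≤ s ^ 3 * |a j| ^ 3 := by positivity
    norm_num [Nat.factorial]
    linarith
  have h2 : ‖((1 - θ : ℝ) : ℂ) - (Real.exp (-θ) : ℂ)‖ ≤ θ ^ 2 := by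
    rw [← Complex.ofReal_sub, Complex.norm_real, Real.norm_eq_abs, abs_sub_comm]
    convert abs_exp_neg_sub_one_add_le hθ0 using 2
    ring
  calc _ = ‖((∑ j, (q j : ℂ) * Complex.exp ((s * a j : ℝ) * Complex.I)) - ((1 - θ : ℝ) : ℂ)) +
        (((1 - θ : ℝ) : ℂ) - (Real.exp (-θ) : ℂ))‖ := by rw [sub_add_sub_cancel]
    _ ≤ _ := (norm_add_le _ _).trans (add_le_add h1 h2)

/-- Replacing `χ` by `e^{-θ}` and then mixing in the exponent: a document is empty with
probability `1 - p`, and otherwise has `m` words. -/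
lemma norm_mixture_sub_exp_le {p θ : ℝ} (hp : 0 ≤ p) (hp1 : p ≤ 1) (hθ : 0 ≤ θ) {z : ℂ}
    (hz : ‖z‖ ≤ 1) (m : ℕ) :
    ‖((1 - p : ℝ) : ℂ) + p * z ^ m - (Real.exp (-(p * m * θ)) : ℂ)‖ ≤
      p * m * ‖z - (Real.exp (-θ) : ℂ)‖ + 2 * (m * θ) ^ 2 := by
  have hw : ‖(Real.exp (-θ) : ℂ)‖ ≤ 1 := by
    rw [Complex.norm_real, Real.norm_of_nonneg (Real.exp_pos _).le]
    exact Real.exp_le_one_iff.2 (by linarith)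
  have h1 := norm_pow_sub_pow_le z _ hz hw m
  have hpow : (Real.exp (-θ) : ℂ) ^ m = (Real.exp (-(m * θ)) : ℂ) := by
    rw [← Complex.ofReal_pow, ← Real.exp_nat_mul]; ring_nf
  rw [hpow] at h1
  set u : ℝ := m * θ
  have hu : 0 ≤ u := by positivity
  have h2 : ‖((1 - p + p * Real.exp (-u) - Real.exp (-(p * u)) : ℝ) : ℂ)‖ ≤ 2 * u ^ 2 := by
    rw [Complex.norm_real, Real.norm_eq_abs]
    have k1 := abs_exp_neg_sub_one_add_le hu
    have k2 := abs_exp_neg_sub_one_add_le (mul_nonneg hp hu)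
    have e : 1 - p + p * Real.exp (-u) - Real.exp (-(p * u)) =
      p * (Real.exp (-u) - 1 + u) - (Real.exp (-(p * u)) - 1 + p * u) := by ring
    rw [e]
    refine (abs_sub _ _).trans ?_
    rw [abs_mul, abs_of_nonneg hp]
    have k3 : (p * u) ^ 2 ≤ u ^ 2 := by
      rw [mul_pow]; exact mul_le_of_le_one_left (sq_nonneg u) (pow_le_one₀ hp hp1)
    have k4 : p * |Real.exp (-u) - 1 + u| ≤ u ^ 2 :=
      (mul_le_of_le_one_left (abs_nonneg _) hp1).trans k1
    linarith
  have e : ((1 - p : ℝ) : ℂ) + p * z ^ m - (Real.exp (-(p * m * θ)) : ℂ) =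
      p * (z ^ m - (Real.exp (-u) : ℂ)) +
        ((1 - p + p * Real.exp (-u) - Real.exp (-(p * u)) : ℝ) : ℂ) := by
    rw [show p * m * θ = p * u by simp only [u]; ring]
    push_cast
    ring
  rw [e]
  refine (norm_add_le _ _).trans (add_le_add ?_ h2)
  rw [norm_mul, Complex.norm_real, Real.norm_of_nonneg hp, mul_assoc]
  exact mul_le_mul_of_nonneg_left h1 hp

section Lengths

variable {N : ℕ → ℕ} {m : ∀ n, Fin (N n) → ℕ}

lemma tendsto_sum_sq_div_sq (hM : Tendsto (fun n ↦ ∑ i, m n i) atTop atTop)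
    (hm : ∀ ε : ℝ, 0 < ε → ∀ᶠ n in atTop, ∀ i, (m n i : ℝ) ≤ ε * ∑ l, (m n l : ℝ)) :
    Tendsto (fun n ↦ (∑ i, (m n i : ℝ) ^ 2) / (∑ i, (m n i : ℝ)) ^ 2) atTop (𝓝 0) := by
  rw [Metric.tendsto_nhds]
  intro ε hε
  filter_upwards [hm (ε / 2) (by positivity), hM.eventually_gt_atTop 0] with n hn hn0
  have hpos : 0 < ∑ i, (m n i : ℝ) := by exact_mod_cast hn0
  rw [Real.dist_eq, sub_zero, abs_of_nonneg (by positivity), div_lt_iff₀ (by positivity)]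
  calc ∑ i, (m n i : ℝ) ^ 2 ≤ ∑ i, ε / 2 * (∑ l, (m n l : ℝ)) * (m n i : ℝ) := by
        refine Finset.sum_le_sum fun i _ ↦ ?_
        rw [sq]
        exact mul_le_mul_of_nonneg_right (hn i) (Nat.cast_nonneg _)
    _ = ε / 2 * (∑ i, (m n i : ℝ)) ^ 2 := by rw [← Finset.mul_sum]; ring
    _ < ε * (∑ i, (m n i : ℝ)) ^ 2 := by
      have : 0 < ε * (∑ i, (m n i : ℝ)) ^ 2 := by positivity
      linarith

lemma tendsto_inv_sqrt_total {p : ℝ} (hp : 0 < p)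
    (hM : Tendsto (fun n ↦ ∑ i, m n i) atTop atTop) :
    Tendsto (fun n ↦ (√(p * ∑ i, (m n i : ℝ)))⁻¹) atTop (𝓝 0) := by
  refine tendsto_inv_atTop_zero.comp (Real.tendsto_sqrt_atTop.comp ?_)
  refine Tendsto.const_mul_atTop hp ?_
  simpa [Function.comp_def] using (tendsto_natCast_atTop_atTop (R := ℝ)).comp hM

/-- The central limit theorem on the side of characteristic functions. The factors are those of
documents that count `m n i` words with probability `p` and none otherwise. -/
lemma tendsto_prod_mixture {q a : ι → ℝ} (hq : ∀ j, 0 ≤ q j) (hq1 : ∑ j, q j = 1)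
    (hqa : ∑ j, q j * a j = 0) {p : ℝ} (hp : 0 < p) (hp1 : p ≤ 1)
    (hM : Tendsto (fun n ↦ ∑ i, m n i) atTop atTop)
    (hm : ∀ ε : ℝ, 0 < ε → ∀ᶠ n in atTop, ∀ i, (m n i : ℝ) ≤ ε * ∑ l, (m n l : ℝ)) :
    Tendsto (fun n ↦ ∏ i, (((1 - p : ℝ) : ℂ) + p * (∑ j, (q j : ℂ) *
        Complex.exp (((√(p * ∑ i, (m n i : ℝ)))⁻¹ * a j : ℝ) * Complex.I)) ^ m n i)) atTop
      (𝓝 (Real.exp (-((∑ j, q j * a j ^ 2) / 2)) : ℂ)) := by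
  set v : ℝ := (∑ j, q j * a j ^ 2) / 2 with hv
  have hv0 : 0 ≤ v := div_nonneg (Finset.sum_nonneg fun j _ ↦ mul_nonneg (hq j) (sq_nonneg _))
    zero_le_two
  set K : ℝ := ∑ j, q j * |a j| ^ 3
  set s : ℕ → ℝ := fun n ↦ (√(p * ∑ i, (m n i : ℝ)))⁻¹ with hs
  have hs0 : Tendsto s atTop (𝓝 0) := tendsto_inv_sqrt_total hp hM
  set S : ℕ → ℝ := fun n ↦ (∑ i, (m n i : ℝ) ^ 2) / (∑ i, (m n i : ℝ)) ^ 2 with hS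
  have hS0 : Tendsto S atTop (𝓝 0) := tendsto_sum_sq_div_sq hM hm
  rw [tendsto_iff_norm_sub_tendsto_zero]
  have hbound :
      Tendsto (fun n ↦ K * s n + s n ^ 2 * v ^ 2 + 2 * (v / p) ^ 2 * S n) atTop (𝓝 0) := by
    have := ((hs0.const_mul K).add ((hs0.pow 2).mul_const (v ^ 2))).add
      (hS0.const_mul (2 * (v / p) ^ 2))
    simpa using this
  have hsmall : ∀ᶠ n in atTop, ∀ j, |s n * a j| ≤ 1 := by
    rw [eventually_all]
    intro j
    have : Tendsto (fun n ↦ |s n * a j|) atTop (𝓝 0) := by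
      simpa using (hs0.mul_const (a j)).abs
    filter_upwards [this.eventually_lt_const zero_lt_one] with n hn using hn.le
  refine tendsto_of_tendsto_of_tendsto_of_le_of_le' tendsto_const_nhds hbound
    (Eventually.of_forall fun _ ↦ norm_nonneg _) ?_
  filter_upwards [hsmall, hM.eventually_gt_atTop 0] with n hn hn0
  have hpos : 0 < ∑ i, (m n i : ℝ) := by exact_mod_cast hn0
  set M : ℝ := ∑ i, (m n i : ℝ)
  have hspos : 0 < s n := by simp only [hs]; positivity
  have hs2 : p * M * s n ^ 2 = 1 := by
    simp only [hs]
    rw [inv_pow, Real.sq_sqrt (by positivity)]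
    exact mul_inv_cancel₀ (by positivity)
  set θ : ℝ := s n ^ 2 * v with hθ
  have hθ0 : 0 ≤ θ := by positivity
  set z : ℂ := ∑ j, (q j : ℂ) * Complex.exp ((s n * a j : ℝ) * Complex.I) with hzdef
  have hz : ‖z‖ ≤ 1 := by
    refine (norm_sum_le _ _).trans (le_of_eq ?_)
    rw [← hq1]
    refine Finset.sum_congr rfl fun j _ ↦ ?_
    rw [norm_mul, Complex.norm_exp_ofReal_mul_I, Complex.norm_real, Real.norm_of_nonneg (hq j),
      mul_one]
  have hD : ‖z - (Real.exp (-θ) : ℂ)‖ ≤ K * s n ^ 3 + θ ^ 2 :=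
    norm_sum_exp_sub_exp_le hq hq1 hqa hspos.le hn
  have hprod : (Real.exp (-v) : ℂ) = ∏ i, (Real.exp (-(p * m n i * θ)) : ℂ) := by
    rw [← Complex.ofReal_prod, ← Real.exp_sum, Finset.sum_neg_distrib, ← Finset.sum_mul,
      ← Finset.mul_sum]
    congr 3
    rw [hθ, ← mul_assoc]
    exact (by rw [hs2, one_mul] : v = p * M * s n ^ 2 * v)
  -- Factor by factor, the exponents `p * m n i * θ` add up to `v` as `p * M * s n ^ 2 = 1`.
  rw [hprod]
  refine (norm_prod_sub_prod_le _ _ _ (fun i _ ↦ ?_) (fun i _ ↦ ?_)).trans ?_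
  · refine (norm_add_le _ _).trans ?_
    rw [norm_mul, norm_pow, Complex.norm_real, Complex.norm_real, Real.norm_of_nonneg hp.le,
      Real.norm_of_nonneg (by linarith)]
    have : p * ‖z‖ ^ m n i ≤ p := mul_le_of_le_one_right hp.le (pow_le_one₀ (norm_nonneg _) hz)
    linarith
  · rw [Complex.norm_real, Real.norm_of_nonneg (Real.exp_pos _).le]
    exact Real.exp_le_one_iff.2 (neg_nonpos.2 (by positivity))
  calc ∑ i, ‖((1 - p : ℝ) : ℂ) + p * z ^ m n i - (Real.exp (-(p * m n i * θ)) : ℂ)‖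
      ≤ ∑ i, (p * m n i * ‖z - (Real.exp (-θ) : ℂ)‖ + 2 * (m n i * θ) ^ 2) :=
        Finset.sum_le_sum fun i _ ↦ norm_mixture_sub_exp_le hp.le hp1 hθ0 hz _
    _ = p * M * ‖z - (Real.exp (-θ) : ℂ)‖ + 2 * θ ^ 2 * ∑ i, (m n i : ℝ) ^ 2 := by
        rw [Finset.sum_add_distrib, ← Finset.sum_mul, ← Finset.mul_sum,
          Finset.mul_sum _ _ (2 * θ ^ 2)]
        congr 1
        exact Finset.sum_congr rfl fun i _ ↦ by ring
    _ ≤ p * M * (K * s n ^ 3 + θ ^ 2) + 2 * θ ^ 2 * ∑ i, (m n i : ℝ) ^ 2 := by gcongr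
    _ = K * s n + s n ^ 2 * v ^ 2 + 2 * (v / p) ^ 2 * S n := by
        have e1 : p * M * (K * s n ^ 3 + θ ^ 2) = K * s n + s n ^ 2 * v ^ 2 := by
          rw [hθ]
          linear_combination (K * s n + s n ^ 2 * v ^ 2) * hs2
        have e2 : s n ^ 2 = (p * M)⁻¹ := eq_inv_of_mul_eq_one_right hs2
        rw [e1, hθ, e2]
        simp only [hS]
        change _ = _ + 2 * (v / p) ^ 2 * ((∑ i, (m n i : ℝ) ^ 2) / M ^ 2)
        field_simp

end Lengths

end Products

/-! ### The law of a document -/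

section Document

variable {ι : Type*} [Fintype ι]

lemma wordProb_pos (α : ι → ℝ) (φ : EuclideanSpace ℝ ι) (y : Fin 2) (j : ι) :
    0 < wordProb α φ y j :=
  div_pos (Real.exp_pos _) (Finset.sum_pos (fun _ _ ↦ Real.exp_pos _) ⟨j, Finset.mem_univ j⟩)

lemma sum_wordProb [Nonempty ι] (α : ι → ℝ) (φ : EuclideanSpace ℝ ι) (y : Fin 2) :
    ∑ j, wordProb α φ y j = 1 := by
  simp only [wordProb]
  rw [← Finset.sum_div, div_self]
  exact (Finset.sum_pos (fun _ _ ↦ Real.exp_pos _) Finset.univ_nonempty).ne'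

/-- The generating function of the multinomial distribution. -/
lemma sum_multinomialMass_mul_prod_pow [DecidableEq ι] (m : ℕ) (q : ι → ℝ) (z : ι → ℂ) :
    ∑ k ∈ Finset.piAntidiag Finset.univ m, (multinomialMass m q k : ℂ) * ∏ j, z j ^ k j =
      (∑ j, (q j : ℂ) * z j) ^ m := by
  rw [Finset.sum_pow_eq_sum_piAntidiag]
  refine Finset.sum_congr rfl fun k hk ↦ ?_
  rw [multinomialMass, if_pos (Finset.mem_piAntidiag.1 hk).1]
  push_cast
  simp_rw [mul_pow, Finset.prod_mul_distrib]
  ring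

lemma sum_multinomialMass [DecidableEq ι] {m : ℕ} {q : ι → ℝ} (hq : ∑ j, q j = 1) :
    ∑ k ∈ Finset.piAntidiag Finset.univ m, multinomialMass m q k = 1 := by
  have h := sum_multinomialMass_mul_prod_pow m q (fun _ ↦ 1)
  simp only [one_pow, Finset.prod_const_one, mul_one] at h
  rw [← Complex.ofReal_sum, ← Complex.ofReal_sum, hq, Complex.ofReal_one, one_pow] at h
  exact_mod_cast h

namespace IsSample

variable {Ω : Type*} [MeasurableSpace Ω] {D : Type*} {μ : Measure Ω} {α : ι → ℝ}
  {φ : EuclideanSpace ℝ ι} {p : ℝ} {m : D → ℕ} {x : D → Ω → ι → ℕ} {y : D → Ω → Fin 2}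

lemma measurable_doc (h : IsSample μ α φ p m x y) (i : D) :
    Measurable fun ω ↦ (x i ω, y i ω) :=
  (h.measurable_counts i).prodMk (h.measurable_response i)

lemma map_doc_singleton (h : IsSample μ α φ p m x y) (i : D) (k : ι → ℕ) (b : Fin 2) :
    (μ.map fun ω ↦ (x i ω, y i ω)).real {(k, b)} =
      multinomialMass (m i) (wordProb α φ b) k * responseMass p b := by
  rw [map_measureReal_apply (h.measurable_doc i) (measurableSet_singleton _), ← h.law i k b]
  congr 1
  ext ω
  simp

variable [IsProbabilityMeasure μ] [Nonempty ι]

lemma ae_sum_counts (h : IsSample μ α φ p m x y) (i : D) : ∀ᵐ ω ∂μ, ∑ j, x i ω j = m i := by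
  classical
  have := Measure.isProbabilityMeasure_map (μ := μ) (h.measurable_doc i).aemeasurable
  set S : Finset ((ι → ℕ) × Fin 2) := Finset.piAntidiag Finset.univ (m i) ×ˢ Finset.univ
  have hS : (μ.map fun ω ↦ (x i ω, y i ω)).real S = 1 := by
    rw [← sum_measureReal_singleton, Finset.sum_product_right]
    simp_rw [h.map_doc_singleton, ← Finset.sum_mul, sum_multinomialMass (sum_wordProb α φ _)]
    simp [responseMass, Fin.sum_univ_two]
  have hS' : ∀ᵐ z ∂μ.map fun ω ↦ (x i ω, y i ω), z ∈ (S : Set ((ι → ℕ) × Fin 2)) := by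
    rw [measureReal_def, ENNReal.toReal_eq_one_iff] at hS
    exact (prob_compl_eq_zero_iff S.measurableSet).2 hS
  filter_upwards [ae_of_ae_map (h.measurable_doc i).aemeasurable hS'] with ω hω
  simp only [S, Finset.coe_product, Set.mem_prod, Finset.mem_coe, Finset.mem_piAntidiag] at hω
  exact hω.1.1

/-- The expectation of a function of a document, as a sum over the responses and over the count
vectors of the prescribed length. -/
lemma integral_doc [DecidableEq ι] {E : Type*} [NormedAddCommGroup E] [NormedSpace ℝ E]
    [CompleteSpace E] (h : IsSample μ α φ p m x y) (i : D) (f : (ι → ℕ) × Fin 2 → E) :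
    ∫ ω, f (x i ω, y i ω) ∂μ = ∑ b, responseMass p b •
      ∑ k ∈ Finset.piAntidiag Finset.univ (m i),
        multinomialMass (m i) (wordProb α φ b) k • f (k, b) := by
  have := Measure.isProbabilityMeasure_map (μ := μ) (h.measurable_doc i).aemeasurable
  set S : Finset ((ι → ℕ) × Fin 2) := Finset.piAntidiag Finset.univ (m i) ×ˢ Finset.univ with hS
  have hS' : ∀ᵐ z ∂μ.map fun ω ↦ (x i ω, y i ω), z ∈ (S : Set ((ι → ℕ) × Fin 2)) := by
    refine (ae_map_iff (h.measurable_doc i).aemeasurable S.measurableSet).2 ?_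
    filter_upwards [h.ae_sum_counts i] with ω hω
    simp [S, hω]
  have hf : StronglyMeasurable f := .of_discrete
  rw [← integral_map (h.measurable_doc i).aemeasurable hf.aestronglyMeasurable,
    ← Measure.restrict_eq_self_of_ae_mem hS', setIntegral_finset, hS, Finset.sum_product_right]
  · simp_rw [h.map_doc_singleton, Finset.smul_sum, smul_smul, mul_comm]
  · exact IntegrableOn.finset

lemma p_le_one (h : IsSample μ α φ p m x y) (i : D) : p ≤ 1 := by
  classical
  have h1 := h.integral_doc i (fun z ↦ if z.2 = 0 then (1 : ℝ) else 0)
  have h0 : 0 ≤ ∫ ω, (if y i ω = 0 then (1 : ℝ) else 0) ∂μ :=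
    integral_nonneg fun ω ↦ by dsimp only; split_ifs <;> norm_num
  rw [h1] at h0
  simp [responseMass, sum_multinomialMass (sum_wordProb α φ _)] at h0
  exact h0

/-- The characteristic function of a linear combination of the counts of a document with
response `1`, set to zero for response `0`. -/
lemma integral_exp_doc (h : IsSample μ α φ p m x y) (i : D) (a : ι → ℝ) :
    ∫ ω, Complex.exp (((if y i ω = 1 then ∑ j, a j * x i ω j else 0 : ℝ) : ℂ) * Complex.I) ∂μ =
      ((1 - p : ℝ) : ℂ) + p * (∑ j, (wordProb α φ 1 j : ℂ) *
        Complex.exp ((a j : ℝ) * Complex.I)) ^ m i := by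
  classical
  rw [h.integral_doc i (fun z ↦
    Complex.exp (((if z.2 = 1 then ∑ j, a j * z.1 j else 0 : ℝ) : ℂ) * Complex.I)),
    Fin.sum_univ_two, ← sum_multinomialMass_mul_prod_pow]
  have h0 := sum_multinomialMass (m := m i) (sum_wordProb α φ 0)
  have h0' : ∑ k ∈ Finset.piAntidiag Finset.univ (m i),
      (multinomialMass (m i) (wordProb α φ 0) k : ℂ) = 1 := by
    rw [← Complex.ofReal_sum, h0, Complex.ofReal_one]
  simp only [responseMass, zero_ne_one, if_false, if_true, Complex.ofReal_zero, zero_mul,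
    Complex.exp_zero, Complex.real_smul, mul_one, h0']
  congr 2
  refine Finset.sum_congr rfl fun k _ ↦ ?_
  congr 1
  simp_rw [← Complex.exp_nat_mul]
  rw [← Complex.exp_sum]
  push_cast
  rw [Finset.sum_mul]
  congr 1
  exact Finset.sum_congr rfl fun j _ ↦ by ring

end IsSample

end Document

/-! ### Limit theorems for the collapsed counts -/

section Limits

variable {ι : Type*} [Fintype ι]

/-- The contribution of a document to the score `X_j / q_j - ∑ l, X_l`, where `X` are the collapsed
counts of response `1`. -/
noncomputable def docScore (q : ι → ℝ) (z : (ι → ℕ) × Fin 2) : EuclideanSpace ℝ ι :=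
  WithLp.toLp 2 fun j ↦ if z.2 = 1 then (z.1 j : ℝ) / q j - ∑ l, (z.1 l : ℝ) else 0

/-- The covariance matrix `diag(q)⁻¹ - 1 1'` of the score of a single word. -/
noncomputable def scoreCov [DecidableEq ι] (q : ι → ℝ) : Matrix ι ι ℝ :=
  Matrix.diagonal (fun j ↦ (q j)⁻¹) - Matrix.vecMulVec 1 1

/-- Centered coefficients: under `q`, the variable `t_j / q_j - ∑ l, t_l` has mean zero. -/
noncomputable def centeredCoeff (q : ι → ℝ) (t : ι → ℝ) (j : ι) : ℝ := t j / q j - ∑ l, t l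

lemma sum_mul_centeredCoeff {q : ι → ℝ} (hq : ∀ j, 0 < q j) (hq1 : ∑ j, q j = 1) (t : ι → ℝ) :
    ∑ j, q j * centeredCoeff q t j = 0 := by
  simp_rw [centeredCoeff, mul_sub, mul_div_cancel₀ _ (hq _).ne']
  rw [Finset.sum_sub_distrib, ← Finset.sum_mul, hq1, one_mul, sub_self]

lemma dotProduct_scoreCov [DecidableEq ι] {q : ι → ℝ} (hq : ∀ j, 0 < q j) (hq1 : ∑ j, q j = 1)
    (t : ι → ℝ) :
    t ⬝ᵥ (scoreCov q).mulVec t = ∑ j, q j * centeredCoeff q t j ^ 2 := by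
  have h1 : ∀ j, q j * centeredCoeff q t j ^ 2 =
      t j * ((q j)⁻¹ * t j) - 2 * (∑ l, t l) * t j + (∑ l, t l) ^ 2 * q j := by
    intro j
    have := (hq j).ne'
    simp only [centeredCoeff]
    field_simp
    ring
  simp_rw [h1]
  rw [Finset.sum_add_distrib, Finset.sum_sub_distrib, ← Finset.mul_sum, ← Finset.mul_sum, hq1,
    scoreCov, Matrix.sub_mulVec, dotProduct_sub]
  have h2 : t ⬝ᵥ (Matrix.diagonal fun j ↦ (q j)⁻¹).mulVec t = ∑ j, t j * ((q j)⁻¹ * t j) := by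
    simp [dotProduct, Matrix.mulVec_diagonal]
  have h3 : t ⬝ᵥ (Matrix.vecMulVec (1 : ι → ℝ) 1).mulVec t = (∑ l, t l) ^ 2 := by
    rw [Matrix.vecMulVec_mulVec, dotProduct_smul, sq]
    simp [dotProduct]
  rw [h2, h3]
  ring

lemma posSemidef_scoreCov [DecidableEq ι] {q : ι → ℝ} (hq : ∀ j, 0 < q j)
    (hq1 : ∑ j, q j = 1) : (scoreCov q).PosSemidef := by
  refine Matrix.PosSemidef.of_dotProduct_mulVec_nonneg ?_ fun t ↦ ?_
  · rw [scoreCov, Matrix.IsHermitian, Matrix.conjTranspose_sub]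
    congr 1
    simp
  · rw [star_trivial, dotProduct_scoreCov hq hq1]
    exact Finset.sum_nonneg fun j _ ↦ mul_nonneg (hq j).le (sq_nonneg _)

lemma inner_docScore (q : ι → ℝ) (z : (ι → ℕ) × Fin 2) (s : ℝ) (t : EuclideanSpace ℝ ι) :
    inner ℝ (docScore q z) (s • t) =
      if z.2 = 1 then ∑ j, s * centeredCoeff q t j * z.1 j else 0 := by
  rw [PiLp.inner_apply]
  simp only [docScore, PiLp.smul_apply, smul_eq_mul, RCLike.inner_apply, conj_trivial]
  split_ifs with hz
  · simp_rw [centeredCoeff, mul_sub, sub_mul, Finset.sum_sub_distrib]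
    congr 1
    · exact Finset.sum_congr rfl fun j _ ↦ by ring
    · rw [← Finset.sum_mul, ← Finset.mul_sum, ← Finset.mul_sum]
  · simp

lemma sum_docScore_apply {D : Type*} [Fintype D] (q : ι → ℝ) (x : D → ι → ℕ) (y : D → Fin 2)
    (j : ι) :
    (∑ i, docScore q (x i, y i)) j =
      (collapsedCounts x y 1 j : ℝ) / q j - ∑ l, (collapsedCounts x y 1 l : ℝ) := by
  rw [WithLp.ofLp_sum, Finset.sum_apply]
  simp only [docScore, collapsedCounts, Nat.cast_sum]
  rw [← Finset.sum_filter, Finset.sum_sub_distrib, Finset.sum_div, Finset.sum_comm]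

variable {Ω : ℕ → Type*} [∀ n, MeasurableSpace (Ω n)] {μ : ∀ n, Measure (Ω n)}
  [∀ n, IsProbabilityMeasure (μ n)] {N : ℕ → ℕ} {m : ∀ n, Fin (N n) → ℕ}
  {x : ∀ n, Fin (N n) → Ω n → ι → ℕ} {y : ∀ n, Fin (N n) → Ω n → Fin 2}
  {α : ι → ℝ} {φ : EuclideanSpace ℝ ι} {p : ℝ}

lemma mean_le_one [Nonempty ι] (hsample : ∀ n, IsSample (μ n) α φ p (m n) (x n) (y n))
    (hM : Tendsto (fun n ↦ ∑ i, m n i) atTop atTop) : p ≤ 1 := by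
  obtain ⟨n, hn⟩ := (hM.eventually_gt_atTop 0).exists
  obtain ⟨i, -, -⟩ := Finset.exists_ne_zero_of_sum_ne_zero hn.ne'
  exact (hsample n).p_le_one i

/-- **Central limit theorem for the score** of the collapsed counts. -/
theorem tendstoInDistribution_score [Nonempty ι] [DecidableEq ι] (hp : 0 < p)
    (hsample : ∀ n, IsSample (μ n) α φ p (m n) (x n) (y n))
    (hM : Tendsto (fun n ↦ ∑ i, m n i) atTop atTop)
    (hm : ∀ ε : ℝ, 0 < ε → ∀ᶠ n in atTop, ∀ i, (m n i : ℝ) ≤ ε * ∑ l, (m n l : ℝ)) :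
    TendstoInDistribution (fun n ω ↦ (√(p * ∑ i, (m n i : ℝ)))⁻¹ •
        ∑ i, docScore (wordProb α φ 1) (x n i ω, y n i ω))
      atTop id μ (multivariateGaussian 0 (scoreCov (wordProb α φ 1))) := by
  set q := wordProb α φ 1
  have hq : ∀ j, 0 < q j := wordProb_pos α φ 1
  have hq1 : ∑ j, q j = 1 := sum_wordProb α φ 1
  have hmeas : ∀ n i, Measurable fun ω ↦ docScore q (x n i ω, y n i ω) := fun n i ↦
    (Measurable.of_discrete (f := docScore q)).comp ((hsample n).measurable_doc i)
  have hmeas' : ∀ n, Measurable fun ω ↦ ∑ i, docScore q (x n i ω, y n i ω) := fun n ↦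
    Finset.measurable_fun_sum _ fun i _ ↦ hmeas n i
  refine ⟨fun n ↦ ((hmeas' n).fun_const_smul _).aemeasurable, aemeasurable_id, ?_⟩
  refine ProbabilityMeasure.tendsto_iff_tendsto_charFun.2 fun t ↦ ?_
  simp only [ProbabilityMeasure.coe_mk, Measure.map_id]
  have hlim := tendsto_prod_mixture (fun j ↦ (hq j).le) hq1
    (sum_mul_centeredCoeff hq hq1 t) hp (mean_le_one hsample hM) hM hm
  rw [charFun_multivariateGaussian (posSemidef_scoreCov hq hq1)]
  convert hlim using 2 with n
  · rw [charFun_map_smul_comp (hmeas' n).aemeasurable,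
      iIndepFun.charFun_map_fun_sum_eq_prod (fun i ↦ (hmeas n i).aemeasurable)
        ((hsample n).indep.comp (fun _ ↦ docScore q) fun _ ↦ .of_discrete),
      Finset.prod_apply]
    refine Finset.prod_congr rfl fun i _ ↦ ?_
    rw [charFun_apply, integral_map (hmeas n i).aemeasurable
      (by exact Continuous.aestronglyMeasurable (by fun_prop)), ← (hsample n).integral_exp_doc]
    simp_rw [inner_docScore]
  · rw [dotProduct_scoreCov hq hq1]
    simp

/-- **Weak law of large numbers** for the number of words in documents with response `1`. -/
theorem tendsto_measure_collapsed_total [Nonempty ι] (hp : 0 < p)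
    (hsample : ∀ n, IsSample (μ n) α φ p (m n) (x n) (y n))
    (hM : Tendsto (fun n ↦ ∑ i, m n i) atTop atTop)
    (hm : ∀ ε : ℝ, 0 < ε → ∀ᶠ n in atTop, ∀ i, (m n i : ℝ) ≤ ε * ∑ l, (m n l : ℝ))
    {ε : ℝ} (hε : 0 < ε) :
    Tendsto (fun n ↦ (μ n).real {ω | ε ≤ |(∑ j, (collapsedCounts (fun i ↦ x n i ω)
      (fun i ↦ y n i ω) 1 j : ℝ)) / (p * ∑ i, (m n i : ℝ)) - 1|}) atTop (𝓝 0) := by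
  classical
  have hbound : Tendsto (fun n ↦ (ε ^ 2 * p)⁻¹ *
      ((∑ i, (m n i : ℝ) ^ 2) / (∑ i, (m n i : ℝ)) ^ 2)) atTop (𝓝 0) := by
    simpa only [mul_zero] using (tendsto_sum_sq_div_sq hM hm).const_mul (ε ^ 2 * p)⁻¹
  refine tendsto_of_tendsto_of_tendsto_of_le_of_le' tendsto_const_nhds hbound
    (Eventually.of_forall fun _ ↦ measureReal_nonneg) ?_
  filter_upwards [hM.eventually_gt_atTop 0] with n hn0
  have hpos : 0 < ∑ i, (m n i : ℝ) := by exact_mod_cast hn0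
  set f : Fin (N n) → (ι → ℕ) × Fin 2 → ℝ := fun i z ↦ if z.2 = 1 then (m n i : ℝ) else 0
  set B : Fin (N n) → Ω n → ℝ := fun i ω ↦ f i (x n i ω, y n i ω) with hB
  have hBm : ∀ i, Measurable (B i) := fun i ↦
    (Measurable.of_discrete (f := f i)).comp ((hsample n).measurable_doc i)
  have hL : ∀ i, MemLp (B i) 2 (μ n) := fun i ↦
    MemLp.of_bound (hBm i).aestronglyMeasurable (m n i : ℝ) (ae_of_all _ fun ω ↦ by
      simp only [hB, f]; split_ifs <;> simp)
  have hq0 := fun k ↦ sum_multinomialMass (m := k) (sum_wordProb α φ 1)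
  have hE : ∀ i, (μ n)[B i] = p * m n i := fun i ↦ by
    rw [(hsample n).integral_doc i (f i)]
    simp [f, responseMass, ← Finset.sum_mul, hq0]
  have hE2 : ∀ i, (μ n)[B i ^ 2] = p * (m n i : ℝ) ^ 2 := fun i ↦ by
    have := (hsample n).integral_doc i (fun z ↦ f i z ^ 2)
    simp only [Pi.pow_apply, hB]
    rw [this]
    simp [f, responseMass, ← Finset.sum_mul, hq0]
  have hvar : variance (∑ i, B i) (μ n) ≤ p * ∑ i, (m n i : ℝ) ^ 2 := by
    rw [IndepFun.variance_sum (fun i _ ↦ hL i) fun i _ j _ hij ↦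
      ((hsample n).indep.comp f fun _ ↦ .of_discrete).indepFun hij, Finset.mul_sum]
    exact Finset.sum_le_sum fun i _ ↦
      (variance_le_expectation_sq (hBm i).aestronglyMeasurable).trans_eq (hE2 i)
  have hmean : (μ n)[∑ i, B i] = p * ∑ i, (m n i : ℝ) := by
    simp only [Finset.sum_apply]
    rw [integral_finsetSum _ fun i _ ↦ (hL i).integrable one_le_two, Finset.mul_sum]
    exact Finset.sum_congr rfl fun i _ ↦ hE i
  have hcheb := meas_ge_le_variance_div_sq (memLp_finsetSum' Finset.univ fun i _ ↦ hL i)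
    (c := ε * (p * ∑ i, (m n i : ℝ))) (by positivity)
  rw [hmean] at hcheb
  have hsub : (μ n) {ω | ε ≤ |(∑ j, (collapsedCounts (fun i ↦ x n i ω)
      (fun i ↦ y n i ω) 1 j : ℝ)) / (p * ∑ i, (m n i : ℝ)) - 1|} ≤
      (μ n) {ω | ε * (p * ∑ i, (m n i : ℝ)) ≤ |(∑ i, B i) ω - p * ∑ i, (m n i : ℝ)|} := by
    refine measure_mono_ae ?_
    filter_upwards [ae_all_iff.2 fun i ↦ (hsample n).ae_sum_counts i] with ω hω
    intro hmem
    have hmem' : ε ≤ |(∑ j, (collapsedCounts (fun i ↦ x n i ω)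
      (fun i ↦ y n i ω) 1 j : ℝ)) / (p * ∑ i, (m n i : ℝ)) - 1| := hmem
    have hsum : ∑ j, (collapsedCounts (fun i ↦ x n i ω) (fun i ↦ y n i ω) 1 j : ℝ) =
        (∑ i, B i) ω := by
      simp only [collapsedCounts, Nat.cast_sum]
      rw [Finset.sum_comm, Finset.sum_apply, Finset.sum_filter]
      refine Finset.sum_congr rfl fun i _ ↦ ?_
      simp only [hB, f]
      rw [← hω i, Nat.cast_sum]
    change ε * (p * ∑ i, (m n i : ℝ)) ≤ |(∑ i, B i) ω - p * ∑ i, (m n i : ℝ)|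
    rw [hsum, div_sub_one (by positivity), abs_div, abs_of_pos (a := p * _) (by positivity),
      le_div_iff₀ (by positivity)] at hmem'
    exact hmem'
  refine (ENNReal.toReal_mono (by finiteness) (hsub.trans hcheb)).trans ?_
  rw [ENNReal.toReal_ofReal (div_nonneg (variance_nonneg _ _) (sq_nonneg _))]
  calc _ ≤ (p * ∑ i, (m n i : ℝ) ^ 2) / (ε * (p * ∑ i, (m n i : ℝ))) ^ 2 := by gcongr
    _ = _ := by field_simp

end Limits

/-! ### The inverse on the normalized loadings -/

section Normalization

variable {ι : Type*} [Fintype ι]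

/-- The projection of loadings to normalized loadings that adds a constant to all of them. -/
noncomputable def normalize (c v : ι → ℝ) (j : ι) : ℝ := v j - (∑ l, c l * v l) / ∑ l, c l

lemma sum_mul_normalize {c : ι → ℝ} (hc : ∑ j, c j ≠ 0) (v : ι → ℝ) :
    ∑ j, c j * normalize c v j = 0 := by
  simp_rw [normalize, mul_sub, Finset.sum_sub_distrib, ← Finset.sum_mul]
  rw [mul_div_cancel₀ _ hc, sub_self]

lemma normalize_of_sum_eq_zero {c v : ι → ℝ} (hv : ∑ j, c j * v j = 0) : normalize c v = v := by
  ext j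
  rw [normalize, hv, zero_div, sub_zero]

lemma normalize_add_const {c : ι → ℝ} (hc : ∑ j, c j ≠ 0) (v : ι → ℝ) (k : ℝ) :
    normalize c (fun j ↦ v j + k) = normalize c v := by
  ext j
  simp_rw [normalize, mul_add, Finset.sum_add_distrib, ← Finset.sum_mul]
  rw [add_div, mul_div_cancel_left₀ _ hc]
  ring

lemma normalize_sub (c v w : ι → ℝ) :
    normalize c (fun j ↦ v j - w j) = normalize c v - normalize c w := by
  ext j
  simp_rw [Pi.sub_apply, normalize, mul_sub, Finset.sum_sub_distrib]
  ring

lemma normalize_const_mul (c v : ι → ℝ) (k : ℝ) :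
    normalize c (fun j ↦ k * v j) = k • normalize c v := by
  ext j
  simp_rw [Pi.smul_apply, normalize, smul_eq_mul, mul_sub, mul_left_comm _ k, ← Finset.mul_sum]
  rw [mul_div_assoc]

section Inverse

variable [DecidableEq ι]

/-- The matrix of `normalize c`. -/
noncomputable def normalizeMatrix (c : ι → ℝ) : Matrix ι ι ℝ :=
  1 - Matrix.vecMulVec 1 ((∑ l, c l)⁻¹ • c)

lemma normalizeMatrix_mulVec (c v : ι → ℝ) : (normalizeMatrix c).mulVec v = normalize c v := by
  ext j
  rw [normalizeMatrix, Matrix.sub_mulVec, Matrix.one_mulVec, Matrix.vecMulVec_mulVec,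
    smul_dotProduct]
  simp [normalize, dotProduct, div_eq_inv_mul]

lemma normalizeMatrix_transpose_mulVec (c v : ι → ℝ) (j : ι) :
    (normalizeMatrix c).transpose.mulVec v j = v j - c j * ((∑ l, v l) / ∑ l, c l) := by
  rw [normalizeMatrix, Matrix.transpose_sub, Matrix.transpose_one, Matrix.transpose_vecMulVec,
    Matrix.sub_mulVec, Matrix.one_mulVec, Matrix.vecMulVec_mulVec]
  simp [dotProduct]
  ring

/-- The inverse of `diag(q) - q q'` on the normalized loadings, in closed form. -/
noncomputable def asymptoticCov (c q : ι → ℝ) : Matrix ι ι ℝ :=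
  normalizeMatrix c * Matrix.diagonal (fun j ↦ (q j)⁻¹) * (normalizeMatrix c).transpose

lemma asymptoticCov_mulVec (c q v : ι → ℝ) : (asymptoticCov c q).mulVec v =
    normalize c fun j ↦ (q j)⁻¹ * (v j - c j * ((∑ l, v l) / ∑ l, c l)) := by
  rw [asymptoticCov, ← Matrix.mulVec_mulVec, ← Matrix.mulVec_mulVec, normalizeMatrix_mulVec]
  congr 1
  ext j
  rw [Matrix.mulVec_diagonal, normalizeMatrix_transpose_mulVec]

lemma sub_vecMulVec_mulVec (q v : ι → ℝ) (j : ι) :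
    (Matrix.diagonal q - Matrix.vecMulVec q q).mulVec v j = q j * (v j - ∑ l, q l * v l) := by
  rw [Matrix.sub_mulVec, Pi.sub_apply, Matrix.mulVec_diagonal, Matrix.vecMulVec_mulVec]
  simp [dotProduct]
  ring

lemma isInverseOn_asymptoticCov {c q : ι → ℝ} (hc : ∑ j, c j ≠ 0) (hq : ∀ j, 0 < q j)
    (hq1 : ∑ j, q j = 1) :
    IsInverseOn c (Matrix.diagonal q - Matrix.vecMulVec q q) (asymptoticCov c q) := by
  constructor
  · intro v hv
    have h0 : ∑ j, q j * (v j - ∑ l, q l * v l) = 0 := by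
      simp_rw [mul_sub, Finset.sum_sub_distrib, ← Finset.sum_mul]
      rw [hq1, one_mul, sub_self]
    rw [asymptoticCov_mulVec]
    simp_rw [sub_vecMulVec_mulVec, h0, zero_div, mul_zero, sub_zero,
      inv_mul_cancel_left₀ (hq _).ne', sub_eq_add_neg]
    rw [normalize_add_const hc, normalize_of_sum_eq_zero hv]
  · rw [asymptoticCov_mulVec]
    ext j
    simp [div_self hc, normalize]

lemma IsInverseOn.eq_asymptoticCov {c q : ι → ℝ} (hc : ∑ j, c j ≠ 0) (hq : ∀ j, 0 < q j)
    (hq1 : ∑ j, q j = 1) {V : Matrix ι ι ℝ}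
    (hV : IsInverseOn c (Matrix.diagonal q - Matrix.vecMulVec q q) V) :
    V = asymptoticCov c q := by
  have hV' := isInverseOn_asymptoticCov hc hq hq1
  refine Matrix.mulVec_injective (funext fun v ↦ ?_)
  -- The image of `W` on normalized loadings consists of the vectors with sum zero.
  set k : ℝ := (∑ l, v l) / ∑ l, c l
  set u : ι → ℝ := fun j ↦ v j - c j * k with hu
  have hu0 : ∑ j, u j = 0 := by
    simp_rw [hu, Finset.sum_sub_distrib, ← Finset.sum_mul]
    simp only [k]
    rw [mul_div_cancel₀ _ hc, sub_self]
  have hW : (Matrix.diagonal q - Matrix.vecMulVec q q).mulVec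
      (normalize c fun j ↦ (q j)⁻¹ * u j) = u := by
    ext j
    rw [sub_vecMulVec_mulVec]
    simp_rw [normalize, mul_sub, Finset.sum_sub_distrib, mul_inv_cancel_left₀ (hq _).ne',
      ← Finset.sum_mul]
    rw [hu0, hq1]
    ring
  have hv : v = u + k • c := by ext j; simp [hu, mul_comm]
  rw [hv, Matrix.mulVec_add, Matrix.mulVec_add, Matrix.mulVec_smul, Matrix.mulVec_smul,
    hV.mulVec_normal, hV'.mulVec_normal, ← hW, hV.left_inv _ (sum_mul_normalize hc _),
    hV'.left_inv _ (sum_mul_normalize hc _)]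

lemma posSemidef_asymptoticCov {c q : ι → ℝ} (hq : ∀ j, 0 < q j) :
    (asymptoticCov c q).PosSemidef := by
  have h := Matrix.PosSemidef.diagonal (d := fun j ↦ (q j)⁻¹) (fun j ↦ (inv_pos.2 (hq j)).le)
  simpa [asymptoticCov] using h.mul_mul_conjTranspose_same (normalizeMatrix c)

/-- Normalizing kills the constants, hence the second term of `scoreCov q`. -/
lemma normalizeMatrix_mul_scoreCov_mul {c : ι → ℝ} (hc : ∑ j, c j ≠ 0) (q : ι → ℝ) :
    normalizeMatrix c * scoreCov q * (normalizeMatrix c).transpose = asymptoticCov c q := by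
  have h1 : (normalizeMatrix c).mulVec 1 = 0 := by
    rw [normalizeMatrix_mulVec]
    ext j
    simp [normalize, div_self hc]
  rw [scoreCov, mul_sub, Matrix.mul_vecMulVec, h1, Matrix.zero_vecMulVec, sub_zero, asymptoticCov]

/-- The image of a centered Gaussian law under a linear map. -/
lemma map_multivariateGaussian (A : Matrix ι ι ℝ) {S : Matrix ι ι ℝ} (hS : S.PosSemidef) :
    (multivariateGaussian 0 S).map (fun v : EuclideanSpace ℝ ι ↦ WithLp.toLp 2 (A.mulVec v)) =
      multivariateGaussian 0 (A * S * A.transpose) := by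
  have hS' : (A * S * A.transpose).PosSemidef := by
    simpa using hS.mul_mul_conjTranspose_same A
  have hcont : Continuous fun v : EuclideanSpace ℝ ι ↦
      (WithLp.toLp 2 (A.mulVec v) : EuclideanSpace ℝ ι) := by
    refine (PiLp.continuous_toLp 2 _).comp ?_
    exact Continuous.matrix_mulVec continuous_const (PiLp.continuous_ofLp 2 _)
  have := Measure.isProbabilityMeasure_map (μ := multivariateGaussian 0 S) hcont.aemeasurable
  refine Measure.ext_of_charFun (funext fun t ↦ ?_)
  have h1 : charFun ((multivariateGaussian 0 S).map 
      (fun v : EuclideanSpace ℝ ι ↦ WithLp.toLp 2 (A.mulVec v))) t =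
      charFun (multivariateGaussian 0 S) (WithLp.toLp 2 (A.transpose.mulVec t)) := by
    rw [charFun_apply, charFun_apply, integral_map hcont.aemeasurable
      (by exact Continuous.aestronglyMeasurable (by fun_prop))]
    refine integral_congr_ae (ae_of_all _ fun v ↦ ?_)
    simp only [EuclideanSpace.inner_eq_star_dotProduct, star_trivial, Matrix.mulVec_transpose,
      ← Matrix.dotProduct_mulVec]
  rw [h1, charFun_multivariateGaussian hS, charFun_multivariateGaussian hS']
  simp only [inner_zero_right]
  rw [← Matrix.mulVec_mulVec, ← Matrix.mulVec_mulVec, Matrix.dotProduct_mulVec t.ofLp A,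
    ← Matrix.mulVec_transpose]

end Inverse

/-! ### The maximum likelihood estimate -/

section MLE

variable {D : Type*} [Fintype D]

/-- **Gibbs' inequality** with its equality case: the frequencies maximize the multinomial
likelihood. -/
lemma eq_freq_of_prod_le {X : ι → ℕ} (hX : ∀ j, 0 < X j) {q : ι → ℝ} (hq : ∀ j, 0 < q j)
    (hq1 : ∑ j, q j = 1)
    (h : ∏ j, ((X j : ℝ) / ∑ l, (X l : ℝ)) ^ X j ≤ ∏ j, q j ^ X j) (j : ι) :
    q j = (X j : ℝ) / ∑ l, (X l : ℝ) := by
  set M : ℝ := ∑ l, (X l : ℝ) with hMdef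
  have hX' : ∀ j, (0 : ℝ) < X j := fun j ↦ by exact_mod_cast hX j
  have hM : 0 < M := Finset.sum_pos (fun j _ ↦ hX' j) ⟨j, Finset.mem_univ j⟩
  set r : ι → ℝ := fun j ↦ q j * M / X j with hr
  have hrpos : ∀ j, 0 < r j := fun j ↦ div_pos (mul_pos (hq j) hM) (hX' j)
  have hlog : 0 ≤ ∑ j, (X j : ℝ) * Real.log (r j) := by
    have h2 := Real.log_le_log (Finset.prod_pos fun j _ ↦ pow_pos (div_pos (hX' j) hM) _) h
    rw [Real.log_prod (fun j _ ↦ (pow_pos (div_pos (hX' j) hM) _).ne'),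
      Real.log_prod (fun j _ ↦ (pow_pos (hq j) _).ne')] at h2
    simp_rw [Real.log_pow] at h2
    rw [← sub_nonneg, ← Finset.sum_sub_distrib] at h2
    refine h2.trans_eq (Finset.sum_congr rfl fun j _ ↦ ?_)
    rw [← mul_sub, ← Real.log_div (hq j).ne' (div_pos (hX' j) hM).ne', div_div_eq_mul_div]
  have hsum : ∑ j, (X j : ℝ) * (r j - 1) = 0 := by
    have : ∀ j, (X j : ℝ) * (r j - 1) = q j * M - X j := fun j ↦ by
      rw [hr, mul_sub, mul_div_cancel₀ _ (hX' j).ne', mul_one]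
    simp_rw [this, Finset.sum_sub_distrib, ← Finset.sum_mul]
    rw [hq1, one_mul, sub_self]
  have hle : ∀ j ∈ Finset.univ, (X j : ℝ) * Real.log (r j) ≤ X j * (r j - 1) := fun j _ ↦
    mul_le_mul_of_nonneg_left (Real.log_le_sub_one_of_pos (hrpos j)) (hX' j).le
  have heq := (Finset.sum_eq_sum_iff_of_le hle).1
    (le_antisymm (Finset.sum_le_sum hle) (hsum.le.trans hlog)) j (Finset.mem_univ j)
  have h1 : r j = 1 := by
    by_contra hne
    exact (Real.log_lt_sub_one_of_pos (hrpos j) hne).ne (mul_left_cancel₀ (hX' j).ne' heq)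
  rw [hr, div_eq_one_iff_eq (hX' j).ne'] at h1
  exact eq_div_of_mul_eq hM.ne' h1

lemma collapsedLikelihood_eq (α : ι → ℝ) (x : D → ι → ℕ) (y : D → Fin 2) :
    ∃ K : ℝ, 0 < K ∧ ∀ ψ : EuclideanSpace ℝ ι,
      collapsedLikelihood α x y ψ = K * ∏ j, wordProb α ψ 1 j ^ collapsedCounts x y 1 j := by
  have h0 : ∀ ψ : EuclideanSpace ℝ ι, wordProb α ψ 0 = wordProb α 0 0 := fun ψ ↦ by
    ext j; simp [wordProb]
  have hmult : ∀ k : ι → ℕ, (0 : ℝ) < Nat.multinomial Finset.univ k := fun k ↦ by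
    exact_mod_cast Nat.multinomial_pos _ _
  refine ⟨multinomialMass (∑ j, collapsedCounts x y 0 j) (wordProb α 0 0)
    (collapsedCounts x y 0) * Nat.multinomial Finset.univ (collapsedCounts x y 1),
    mul_pos ?_ (hmult _), fun ψ ↦ ?_⟩
  · rw [multinomialMass, if_pos rfl]
    exact mul_pos (hmult _) (Finset.prod_pos fun j _ ↦ pow_pos (wordProb_pos _ _ _ j) _)
  · rw [collapsedLikelihood, Fin.prod_univ_two, h0, mul_assoc]
    congr 1
    rw [multinomialMass, if_pos rfl]

lemma log_wordProb_one (α : ι → ℝ) (ψ : EuclideanSpace ℝ ι) (j : ι) :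
    Real.log (wordProb α ψ 1 j) = α j + ψ j - Real.log (∑ l, Real.exp (α l + ψ l)) := by
  have hpos : 0 < ∑ l, Real.exp (α l + ψ l) :=
    Finset.sum_pos (fun _ _ ↦ Real.exp_pos _) ⟨j, Finset.mem_univ j⟩
  simp only [wordProb, Fin.val_one, Nat.cast_one, mul_one]
  rw [Real.log_div (Real.exp_pos _).ne' hpos.ne', Real.log_exp]

/-- Normalized loadings are recovered from the word probabilities of response `1`. -/
lemma normalize_log_wordProb {c : ι → ℝ} (hc : ∑ j, c j ≠ 0) (α : ι → ℝ)
    {ψ : EuclideanSpace ℝ ι} (hψ : ψ ∈ paramSpace c) :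
    normalize c (fun j ↦ Real.log (wordProb α ψ 1 j) - α j) = ψ := by
  simp_rw [log_wordProb_one, show ∀ j, α j + ψ j - Real.log (∑ l, Real.exp (α l + ψ l)) - α j =
    ψ j + -Real.log (∑ l, Real.exp (α l + ψ l)) from fun j ↦ by ring]
  rw [normalize_add_const hc, normalize_of_sum_eq_zero hψ]

lemma wordProb_normalize_log (α c : ι → ℝ) {X : ι → ℕ} (hX : ∀ j, 0 < X j) (j : ι) :
    wordProb α (WithLp.toLp 2 (normalize c fun j ↦ Real.log (X j) - α j)) 1 j =
      (X j : ℝ) / ∑ l, (X l : ℝ) := by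
  have hX' : ∀ j, (0 : ℝ) < X j := fun j ↦ by exact_mod_cast hX j
  set k : ℝ := (∑ l, c l * (Real.log (X l) - α l)) / ∑ l, c l with hk
  have h1 : ∀ j, Real.exp (α j + normalize c (fun j ↦ Real.log (X j) - α j) j) =
      X j * Real.exp (-k) := fun j ↦ by
    rw [normalize, ← hk, show α j + (Real.log (X j) - α j - k) = Real.log (X j) + -k by ring,
      Real.exp_add, Real.exp_log (hX' j)]
  simp only [wordProb, Fin.val_one, Nat.cast_one, mul_one, h1]
  rw [← Finset.sum_mul, mul_div_mul_right _ _ (Real.exp_pos _).ne']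

variable {α c : ι → ℝ} {x : D → ι → ℕ} {y : D → Fin 2}

/-- If all words occur, there is a maximum likelihood estimate, which fits the frequencies. -/
lemma isMLE_normalize_log [Nonempty ι] (hc : ∑ j, c j ≠ 0)
    (hX : ∀ j, 0 < collapsedCounts x y 1 j) :
    IsMLE α c x y
      (WithLp.toLp 2 (normalize c fun j ↦ Real.log (collapsedCounts x y 1 j) - α j)) := by
  refine ⟨sum_mul_normalize hc _, fun ψ _ ↦ ?_⟩
  obtain ⟨K, hK, hL⟩ := collapsedLikelihood_eq α x y
  simp only [Set.mem_ofPred_eq, hL, wordProb_normalize_log α c hX]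
  refine mul_le_mul_of_nonneg_left ?_ hK.le
  by_contra! h
  have := eq_freq_of_prod_le hX (wordProb_pos α ψ 1) (sum_wordProb α ψ 1) h.le
  simp_rw [this] at h
  exact h.false

lemma IsMLE.wordProb_eq [Nonempty ι] (hc : ∑ j, c j ≠ 0)
    (hX : ∀ j, 0 < collapsedCounts x y 1 j) {ψ : EuclideanSpace ℝ ι} (hψ : IsMLE α c x y ψ)
    (j : ι) :
    wordProb α ψ 1 j =
      (collapsedCounts x y 1 j : ℝ) / ∑ l, (collapsedCounts x y 1 l : ℝ) := by
  obtain ⟨K, hK, hL⟩ := collapsedLikelihood_eq α x y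
  have h := hψ.2 (isMLE_normalize_log (α := α) hc hX).1
  simp only [Set.mem_ofPred_eq, hL, wordProb_normalize_log α c hX] at h
  exact eq_freq_of_prod_le hX (wordProb_pos α ψ 1) (sum_wordProb α ψ 1)
    (le_of_mul_le_mul_left h hK) j

/-- The error of the maximum likelihood estimate in closed form. -/
lemma IsMLE.sub_eq [Nonempty ι] (hc : ∑ j, c j ≠ 0) (hX : ∀ j, 0 < collapsedCounts x y 1 j)
    {ψ φ : EuclideanSpace ℝ ι} (hψ : IsMLE α c x y ψ) (hφ : φ ∈ paramSpace c) :
    ψ - φ = WithLp.toLp 2 (normalize c fun j ↦ Real.log ((collapsedCounts x y 1 j : ℝ) /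
      ((∑ l, (collapsedCounts x y 1 l : ℝ)) * wordProb α φ 1 j))) := by
  have h1 : ∀ j, Real.log ((collapsedCounts x y 1 j : ℝ) /
      ((∑ l, (collapsedCounts x y 1 l : ℝ)) * wordProb α φ 1 j)) =
      (Real.log (wordProb α ψ 1 j) - α j) - (Real.log (wordProb α φ 1 j) - α j) := fun j ↦ by
    rw [← div_div, ← hψ.wordProb_eq hc hX,
      Real.log_div (wordProb_pos _ _ _ _).ne' (wordProb_pos _ _ _ _).ne']
    ring
  simp_rw [h1]
  rw [normalize_sub, normalize_log_wordProb hc α hψ.1, normalize_log_wordProb hc α hφ]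
  rfl

end MLE

end Normalization

/-! ### The error as a function of the score -/

section Error

variable {ι : Type*} [Fintype ι]

/-- A globally continuous version of `log (1 + u) / u`, extended by its limit `1` at `u = 0`; the
logarithm is made constant below `u = -1/2`. -/
noncomputable def logQuotient : ℝ → ℝ := dslope (fun u ↦ Real.log (max (1 + u) (1 / 2))) 0

lemma hasDerivAt_log_max : HasDerivAt (fun u : ℝ ↦ Real.log (max (1 + u) (1 / 2))) 1 0 := by
  have h : HasDerivAt (fun u : ℝ ↦ Real.log (1 + u)) 1 0 := by
    simpa using ((hasDerivAt_id (0 : ℝ)).const_add 1).log (by norm_num)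
  refine h.congr_of_eventuallyEq ?_
  filter_upwards [lt_mem_nhds (show (-1 / 2 : ℝ) < 0 by norm_num)] with u hu
  rw [max_eq_left (by linarith)]

lemma logQuotient_zero : logQuotient 0 = 1 := by
  rw [logQuotient, dslope_same, hasDerivAt_log_max.deriv]

lemma continuous_logQuotient : Continuous logQuotient := by
  rw [← continuousOn_univ, logQuotient, continuousOn_dslope univ_mem]
  refine ⟨Continuous.continuousOn ?_, hasDerivAt_log_max.differentiableAt⟩
  refine Continuous.log (by fun_prop) fun u ↦ ?_
  have : (1 / 2 : ℝ) ≤ max (1 + u) (1 / 2) := le_max_right _ _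
  linarith

lemma mul_logQuotient {u : ℝ} (hu : -1 / 2 ≤ u) : u * logQuotient u = Real.log (1 + u) := by
  have h := sub_smul_dslope (fun u : ℝ ↦ Real.log (max (1 + u) (1 / 2))) 0 u
  rw [max_eq_left (by linarith), max_eq_left (by norm_num)] at h
  simpa [logQuotient] using h

/-- The scaled error `√(π M) (φhat - φ)` as a function of the scaled score `w`, the ratio `r` of
the number of words with response `1` to its mean `π M`, and `h = (π M)^(-1/2)`. The
truncation at `r = 1 / 2` and the one in `logQuotient` make it continuous everywhere, also at
`h = 0`; both are inactive on `regularRegion`. -/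
noncomputable def errorMap (c : ι → ℝ) (z : EuclideanSpace ℝ ι × (ℝ × ℝ)) :
    EuclideanSpace ℝ ι :=
  WithLp.toLp 2 (normalize c fun j ↦ z.1 j / max z.2.1 (1 / 2) *
    logQuotient (z.2.2 * (z.1 j / max z.2.1 (1 / 2))))

lemma continuous_errorMap (c : ι → ℝ) : Continuous (errorMap c) := by
  refine (PiLp.continuous_toLp 2 _).comp (continuous_pi fun j ↦ ?_)
  have h1 : ∀ j, Continuous fun z : EuclideanSpace ℝ ι × (ℝ × ℝ) ↦
      z.1 j / max z.2.1 (1 / 2) := fun j ↦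
    Continuous.div (by fun_prop) (by fun_prop) fun z ↦
      (lt_of_lt_of_le (by norm_num) (le_max_right z.2.1 (1 / 2))).ne'
  have h2 : ∀ j, Continuous fun z : EuclideanSpace ℝ ι × (ℝ × ℝ) ↦
      z.1 j / max z.2.1 (1 / 2) * logQuotient (z.2.2 * (z.1 j / max z.2.1 (1 / 2))) := fun j ↦
    (h1 j).mul (continuous_logQuotient.comp (Continuous.mul (by fun_prop) (h1 j)))
  exact (h2 j).sub (Continuous.div_const
    (continuous_finsetSum _ fun l _ ↦ continuous_const.mul (h2 l)) _)

lemma errorMap_one_zero [DecidableEq ι] (c : ι → ℝ) (w : EuclideanSpace ℝ ι) :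
    errorMap c (w, (1, 0)) = WithLp.toLp 2 ((normalizeMatrix c).mulVec w) := by
  have h : max (1 : ℝ) (1 / 2) = 1 := by norm_num
  simp only [errorMap, h, div_one, zero_mul, logQuotient_zero, mul_one, normalizeMatrix_mulVec]

/-- The region in which all words occur in documents with response `1`, and in which no truncation
in `errorMap` is active. -/
def regularRegion (ι : Type*) [Fintype ι] : Set (EuclideanSpace ℝ ι × (ℝ × ℝ)) :=
  {z | 1 / 2 < z.2.1 ∧ ∀ j, -1 / 4 < z.2.2 * z.1 j}

lemma isOpen_regularRegion : IsOpen (regularRegion ι) := by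
  have h : regularRegion ι = {z | 1 / 2 < z.2.1} ∩ ⋂ j, {z | -1 / 4 < z.2.2 * z.1 j} := by
    ext; simp [regularRegion]
  rw [h]
  exact (isOpen_lt continuous_const (by fun_prop)).inter
    (isOpen_iInter_of_finite fun j ↦ isOpen_lt continuous_const (by fun_prop))

/-- In the regular region the maximum likelihood estimate exists, and its scaled error is the value
of `errorMap`. -/
lemma smul_sub_eq_errorMap {D : Type*} [Fintype D] [Nonempty ι] {α c : ι → ℝ}
    (hc : ∑ j, c j ≠ 0) {φ ψ : EuclideanSpace ℝ ι} (hφ : φ ∈ paramSpace c) {x : D → ι → ℕ}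
    {y : D → Fin 2} (hψ : (∃ ψ', IsMLE α c x y ψ') → IsMLE α c x y ψ) {L : ℝ} (hL : 0 ≤ L)
    (hmem : ((√L)⁻¹ • ∑ i, docScore (wordProb α φ 1) (x i, y i),
      ((∑ j, (collapsedCounts x y 1 j : ℝ)) / L, (√L)⁻¹)) ∈ regularRegion ι) :
    √L • (ψ - φ) = errorMap c ((√L)⁻¹ • ∑ i, docScore (wordProb α φ 1) (x i, y i),
      ((∑ j, (collapsedCounts x y 1 j : ℝ)) / L, (√L)⁻¹)) := by
  obtain ⟨hr, hw⟩ := hmem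
  set X := collapsedCounts x y 1
  set q := wordProb α φ 1
  have hq : ∀ j, 0 < q j := wordProb_pos α φ 1
  set T : ℝ := ∑ j, (X j : ℝ)
  simp only at hr
  -- For `L = 0` the ratio `T / L` is the junk value `0`, which lies outside the region.
  have hL0 : L ≠ 0 := by
    rintro rfl
    rw [div_zero] at hr
    linarith
  have hLpos : 0 < L := lt_of_le_of_ne hL hL0.symm
  have hT : 0 < T := by
    by_contra! h
    have := div_nonpos_of_nonpos_of_nonneg h hL
    linarith
  have hsq : √L ≠ 0 := (Real.sqrt_pos.2 hLpos).ne'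
  have hw1 : ∀ j, ((√L)⁻¹ • ∑ i, docScore q (x i, y i)) j = (√L)⁻¹ * (X j / q j - T) :=
    fun j ↦ by rw [PiLp.smul_apply, sum_docScore_apply, smul_eq_mul]
  have hu : ∀ j, (√L)⁻¹ * (((√L)⁻¹ • ∑ i, docScore q (x i, y i)) j / (T / L)) =
      X j / (T * q j) - 1 := fun j ↦ by
    have h2 : (√L)⁻¹ * (√L)⁻¹ = L⁻¹ := by rw [← mul_inv, Real.mul_self_sqrt hL]
    rw [hw1, mul_div_assoc, ← mul_assoc, h2]
    have := (hq j).ne'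
    field_simp
  have hlow : ∀ j, -1 / 2 < X j / (T * q j) - 1 := fun j ↦ by
    have h3 := hw j
    simp only at h3
    rw [← hu, ← mul_div_assoc, lt_div_iff₀ (by positivity)]
    linarith
  have hX : ∀ j, 0 < X j := fun j ↦ by
    by_contra! h
    have h4 := hlow j
    rw [Nat.le_zero.1 h] at h4
    norm_num at h4
  have hmle := hψ ⟨_, isMLE_normalize_log hc hX⟩
  rw [hmle.sub_eq hc hX hφ, errorMap, ← WithLp.toLp_smul, ← normalize_const_mul]
  congr 2
  ext j
  simp only
  rw [max_eq_left hr.le, hu]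
  calc √L * Real.log (X j / (T * q j))
      = √L * ((X j / (T * q j) - 1) * logQuotient (X j / (T * q j) - 1)) := by
        rw [mul_logQuotient (hlow j).le, add_sub_cancel]
    _ = _ := by
        rw [← mul_assoc]
        congr 1
        rw [← hu, mul_inv_cancel_left₀ hsq]

lemma tendstoInDistribution_id_of_map_eq {Ω : ℕ → Type*} {mΩ : ∀ n, MeasurableSpace (Ω n)}
    {μ : ∀ n, Measure (Ω n)} [∀ n, IsProbabilityMeasure (μ n)] {Ω' E : Type*}
    {m' : MeasurableSpace Ω'} {μ' : Measure Ω'} [IsProbabilityMeasure μ'] [TopologicalSpace E]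
    [MeasurableSpace E] [OpensMeasurableSpace E] {X : ∀ n, Ω n → E} {Z : Ω' → E}
    (h : TendstoInDistribution X atTop Z μ μ') {ν : Measure E} [IsProbabilityMeasure ν]
    (hν : μ'.map Z = ν) : TendstoInDistribution X atTop id μ ν := by
  subst hν
  refine ⟨h.forall_aemeasurable, aemeasurable_id, ?_⟩
  simpa only [Measure.map_id] using h.tendsto

end Error

end MNIR

theorem proposition1 {ι : Type*} [Fintype ι] [DecidableEq ι]
    -- intercepts, normalization, true loadings and mean response
    (α : ι → ℝ) (c : ι → ℝ) (hc : ∑ j, c j ≠ 0)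
    (φ : EuclideanSpace ℝ ι) (hφ : φ ∈ MNIR.paramSpace c) (p : ℝ) (hp : 0 < p)
    -- for each `n`, a corpus of `N n` documents, document `i` having `m n i` words
    {Ω : ℕ → Type*} [∀ n, MeasurableSpace (Ω n)] (μ : ∀ n, Measure (Ω n))
    [∀ n, IsProbabilityMeasure (μ n)] (N : ℕ → ℕ) (m : ∀ n, Fin (N n) → ℕ)
    (x : ∀ n, Fin (N n) → Ω n → ι → ℕ) (y : ∀ n, Fin (N n) → Ω n → Fin 2)
    (hsample : ∀ n, MNIR.IsSample (μ n) α φ p (m n) (x n) (y n))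
    -- the number of words grows, and no single document dominates the corpus
    (hM : Tendsto (fun n ↦ ∑ i, m n i) atTop atTop)
    (hm : ∀ ε : ℝ, 0 < ε → ∀ᶠ n in atTop, ∀ i, (m n i : ℝ) ≤ ε * ∑ l, (m n l : ℝ))
    -- the estimator: a maximum likelihood estimate whenever there is one
    (φhat : ∀ n, Ω n → EuclideanSpace ℝ ι) (hmeas : ∀ n, AEMeasurable (φhat n) (μ n))
    (hMLE : ∀ n, ∀ᵐ ω ∂μ n,
      (∃ ψ, MNIR.IsMLE α c (fun i ↦ x n i ω) (fun i ↦ y n i ω) ψ) →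
        MNIR.IsMLE α c (fun i ↦ x n i ω) (fun i ↦ y n i ω) (φhat n ω)) :
    (∃! V, MNIR.IsInverseOn c (MNIR.infoMatrix α φ) V) ∧
    ∀ V, MNIR.IsInverseOn c (MNIR.infoMatrix α φ) V →
      V.PosSemidef ∧
      TendstoInDistribution
        (fun n ω ↦ √(p * (MNIR.totalWords (fun i ↦ x n i ω) : ℝ)) • (φhat n ω - φ))
        atTop id μ (multivariateGaussian 0 V) := by
  have : Nonempty ι := not_isEmpty_iff.1 fun _ ↦ hc (by simp)
  set q := MNIR.wordProb α φ 1
  have hq : ∀ j, 0 < q j := MNIR.wordProb_pos α φ 1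
  have hq1 : ∑ j, q j = 1 := MNIR.sum_wordProb α φ 1
  refine ⟨⟨MNIR.asymptoticCov c q, MNIR.isInverseOn_asymptoticCov hc hq hq1,
    fun V hV ↦ hV.eq_asymptoticCov hc hq hq1⟩, fun V hV ↦ ?_⟩
  obtain rfl := hV.eq_asymptoticCov hc hq hq1
  refine ⟨MNIR.posSemidef_asymptoticCov hq, ?_⟩
  have hcounts : ∀ n i j, Measurable fun ω ↦ x n i ω j := fun n i j ↦
    (measurable_pi_apply j).comp ((hsample n).measurable_counts i)
  have hcollapsed : ∀ n j, Measurable fun ω ↦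
      MNIR.collapsedCounts (fun i ↦ x n i ω) (fun i ↦ y n i ω) 1 j := fun n j ↦ by
    simp only [MNIR.collapsedCounts, Finset.sum_filter]
    exact Finset.measurable_fun_sum _ fun i _ ↦ Measurable.ite
      ((hsample n).measurable_response i (measurableSet_singleton 1)) (hcounts n i j)
      measurable_const
  have hR : ∀ ε : ℝ, 0 < ε → Tendsto (fun n ↦ (μ n).real {ω | ε ≤
      ‖((∑ j, (MNIR.collapsedCounts (fun i ↦ x n i ω) (fun i ↦ y n i ω) 1 j : ℝ)) /
        (p * ∑ i, (m n i : ℝ)), (√(p * ∑ i, (m n i : ℝ)))⁻¹) - ((1, 0) : ℝ × ℝ)‖})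
      atTop (𝓝 0) := fun ε hε ↦ by
    refine (MNIR.tendsto_measure_collapsed_total hp hsample hM hm hε).congr' ?_
    filter_upwards [(MNIR.tendsto_inv_sqrt_total hp hM).eventually_lt_const hε] with n hn
    congr 1
    ext ω
    have h0 : |(√(p * ∑ i, (m n i : ℝ)))⁻¹| < ε := by rwa [abs_of_nonneg (by positivity)]
    rw [abs_inv] at h0
    simp [Prod.norm_def, h0.not_ge]
  have key := MNIR.tendstoInDistribution_of_eq_comp_of_mem_open
    (Y := fun n ω ↦ √(p * (MNIR.totalWords (fun i ↦ x n i ω) : ℝ)) • (φhat n ω - φ))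
    (MNIR.tendstoInDistribution_score hp hsample hM hm)
    (R := fun n ω ↦ ((∑ j, (MNIR.collapsedCounts (fun i ↦ x n i ω) (fun i ↦ y n i ω) 1 j : ℝ)) /
        (p * ∑ i, (m n i : ℝ)), (√(p * ∑ i, (m n i : ℝ)))⁻¹))
    (fun n ↦ ?_) hR (MNIR.continuous_errorMap c) MNIR.isOpen_regularRegion
    (ae_of_all _ fun w ↦ ?_) (fun n ↦ ?_) (fun n ↦ ?_)
  · refine MNIR.tendstoInDistribution_id_of_map_eq key ?_
    simp only [MNIR.errorMap_one_zero, id]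
    rw [MNIR.map_multivariateGaussian _ (MNIR.posSemidef_scoreCov hq hq1),
      MNIR.normalizeMatrix_mul_scoreCov_mul hc]
  · refine (Measurable.prodMk (Measurable.div_const ?_ _) measurable_const).aemeasurable
    exact Finset.measurable_fun_sum _ fun j _ ↦
      (Measurable.of_discrete (f := fun k : ℕ ↦ (k : ℝ))).comp (hcollapsed n j)
  · constructor <;> norm_num
  · have htotal : Measurable fun ω ↦ MNIR.totalWords (fun i ↦ x n i ω) :=
      Finset.measurable_fun_sum _ fun i _ ↦ Finset.measurable_fun_sum _ fun j _ ↦ hcounts n i j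
    exact ((Measurable.of_discrete (f := fun k : ℕ ↦ √(p * (k : ℝ)))).comp
      htotal).aemeasurable.smul ((hmeas n).sub_const φ)
  · filter_upwards [hMLE n, ae_all_iff.2 fun i ↦ (hsample n).ae_sum_counts i] with ω hω hsum hmem
    have htotal : (MNIR.totalWords (fun i ↦ x n i ω) : ℝ) = ∑ i, (m n i : ℝ) := by
      rw [MNIR.totalWords, Finset.sum_congr rfl fun i _ ↦ hsum i, Nat.cast_sum]
    rw [htotal]
    exact MNIR.smul_sub_eq_errorMap hc hφ hω (by positivity) hmem
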